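/- Let $\mathscr{C}_{\mathbb{Z}}$ be the extended bicyclic semigroup, that is, the set $\mathbb{Z}\times\mathbb{Z}$ with the operation $$(a,b)\cdot(c,d)=\begin{cases}(a-b+c,\,d), & b<c,\\ (a,\,d), & b=c,\\ (a,\,d+b-c), & b>c.\end{cases}$$ A topological inverse semigroup is an inverse semigroup with a topology for which multiplication is jointly continuous and inversion is continuous. Let $S_3=\mathscr{C}_{\mathbb{Z}}\sqcup\mathbb{Z}$, with the operation which extends those of $\mathscr{C}_{\mathbb{Z}}$ and of the additive group $\mathbb{Z}$ by $$(a,b)\cdot n=n\cdot(a,b)=n+b-a\in\mathbb{Z}\qquad((a,b)\in\mathscr{C}_{\mathbb{Z}},\ n\in\mathbb{Z}),$$ and let $\tau_3$ be the topology on $S_3$ in which every point of $\mathscr{C}_{\mathbb{Z}}$ is isolated and a base at the point $k\in\mathbb{Z}$ consists of the sets $U_n(k)$, $n=1,2,3,\ldots$, where $$U_n(k)=\begin{cases}\{k\}\cup\{(a,a+k)\mid a=n,n+1,n+2,\ldots\}, & k\geqslant 0,\\ \{k\}\cup\{(a-k,a)\mid a=n,n+1,n+2,\ldots\}, & k\leqslant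 0.\end{cases}$$ Let $T$ be a Hausdorff locally compact topological inverse semigroup which contains $\mathscr{C}_{\mathbb{Z}}$ as a dense subsemigroup, and put $${\uparrow}\mathscr{C}_{\mathbb{Z}}=\mathscr{C}_{\mathbb{Z}}\cup\{x\in T\setminus\mathscr{C}_{\mathbb{Z}}\mid x\cdot y\in\mathscr{C}_{\mathbb{Z}}\text{ for some }y\in\mathscr{C}_{\mathbb{Z}}\}.$$ If $I=T\setminus{\uparrow}\mathscr{C}_{\mathbb{Z}}\neq\varnothing$ and ${\uparrow}\mathscr{C}_{\mathbb{Z}}=\mathscr{C}_{\mathbb{Z}}$, then $T$ is topologically isomorphic to $(S_3,\tau_3)$, i.e. there is a semigroup isomorphism of $T$ onto $S_3$ which is a homeomorphism. -/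

import Mathlib

/-- An inverse semigroup: every `x` has a unique `y` with `x * y * x = x` and `y * x * y = y`,
and this `y` is denoted `x⁻¹`. -/
class InverseSemigroup (S : Type*) extends Semigroup S, Inv S where
  mul_inv_mul : ∀ x : S, x * x⁻¹ * x = x
  inv_mul_inv : ∀ x : S, x⁻¹ * x * x⁻¹ = x⁻¹
  inv_unique : ∀ x y : S, x * y * x = x → y * x * y = y → y = x⁻¹

/-- A topological inverse semigroup (Hausdorffness is a separate assumption): multiplication is
jointly continuous and inversion is continuous. -/
class TopologicalInverseSemigroup (S : Type*) [InverseSemigroup S] [TopologicalSpace S] :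
    Prop extends ContinuousMul S, ContinuousInv S

/-- The underlying set `ℤ × ℤ` of the extended bicyclic semigroup (as a type of its own, because
`ℤ × ℤ` carries the componentwise multiplication). -/
@[ext]
structure ExtBicyclic where
  fst : ℤ
  snd : ℤ

namespace ExtBicyclic

instance : Mul ExtBicyclic where
  mul x y :=
    if x.snd < y.fst then ⟨x.fst - x.snd + y.fst, y.snd⟩
    else if x.snd = y.fst then ⟨x.fst, y.snd⟩
    else ⟨x.fst, y.snd + x.snd - y.fst⟩

theorem mul_def (x y : ExtBicyclic) :
    x * y = if x.snd < y.fst then ⟨x.fst - x.snd + y.fst, y.snd⟩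
      else if x.snd = y.fst then ⟨x.fst, y.snd⟩
      else ⟨x.fst, y.snd + x.snd - y.fst⟩ := rfl

theorem mul_fst (x y : ExtBicyclic) : (x * y).fst = x.fst - x.snd + max x.snd y.fst := by
  rw [mul_def]; split_ifs <;> simp only <;> omega

theorem mul_snd (x y : ExtBicyclic) : (x * y).snd = y.snd - y.fst + max x.snd y.fst := by
  rw [mul_def]; split_ifs <;> simp only <;> omega

/-- The extended bicyclic semigroup `𝒞_ℤ`. -/
instance : Semigroup ExtBicyclic where
  mul_assoc x y z := by
    ext <;> simp only [mul_fst, mul_snd] <;> omega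

end ExtBicyclic

/-- The underlying set `𝒞_ℤ ⊔ ℤ` of the semigroup `S₃`. -/
inductive S3 where
  | bi : ExtBicyclic → S3
  | int : ℤ → S3

namespace S3

instance : Mul S3 where
  mul
    | bi x, bi y => bi (x * y)
    | bi x, int n => int (n + x.snd - x.fst)
    | int n, bi x => int (n + x.snd - x.fst)
    | int m, int n => int (m + n)

instance : Inv S3 where
  inv
    | bi x => bi ⟨x.snd, x.fst⟩
    | int n => int (-n)

theorem bi_mul_bi (x y : ExtBicyclic) : bi x * bi y = bi (x * y) := rfl
theorem bi_mul_int (x : ExtBicyclic) (n : ℤ) : bi x * int n = int (n + x.snd - x.fst) := rfl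
theorem int_mul_bi (n : ℤ) (x : ExtBicyclic) : int n * bi x = int (n + x.snd - x.fst) := rfl
theorem int_mul_int (m n : ℤ) : int m * int n = int (m + n) := rfl
theorem inv_bi (x : ExtBicyclic) : (bi x)⁻¹ = bi ⟨x.snd, x.fst⟩ := rfl
theorem inv_int (n : ℤ) : (int n)⁻¹ = int (-n) := rfl

instance : InverseSemigroup S3 where
  mul_assoc x y z := by
    rcases x with x | m <;> rcases y with y | n <;> rcases z with z | k <;>
      simp only [bi_mul_bi, bi_mul_int, int_mul_bi, int_mul_int, mul_assoc, int.injEq,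
        ExtBicyclic.mul_fst, ExtBicyclic.mul_snd] <;> omega
  mul_inv_mul x := by
    rcases x with x | m <;>
      simp only [bi_mul_bi, int_mul_int, inv_bi, inv_int, bi.injEq, int.injEq,
        ExtBicyclic.ext_iff, ExtBicyclic.mul_fst, ExtBicyclic.mul_snd] <;> omega
  inv_mul_inv x := by
    rcases x with x | m <;>
      simp only [bi_mul_bi, int_mul_int, inv_bi, inv_int, bi.injEq, int.injEq,
        ExtBicyclic.ext_iff, ExtBicyclic.mul_fst, ExtBicyclic.mul_snd] <;> omega
  inv_unique x y := by
    rcases x with x | m <;> rcases y with y | n <;>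
      simp only [bi_mul_bi, bi_mul_int, int_mul_bi, int_mul_int, inv_bi, inv_int, bi.injEq,
        int.injEq, reduceCtorEq, ExtBicyclic.ext_iff, ExtBicyclic.mul_fst,
        ExtBicyclic.mul_snd] <;> first | omega | simp

/-- The basic neighbourhood `U_n(k)` of the point `k ∈ ℤ ⊆ S₃`. -/
def basicNhd (n : ℕ) (k : ℤ) : Set S3 :=
  if 0 ≤ k then {int k} ∪ {s | ∃ a : ℤ, (n : ℤ) ≤ a ∧ s = bi ⟨a, a + k⟩}
  else {int k} ∪ {s | ∃ a : ℤ, (n : ℤ) ≤ a ∧ s = bi ⟨a - k, a⟩}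

theorem basicNhd_anti {m n : ℕ} (h : m ≤ n) (k : ℤ) : basicNhd n k ⊆ basicNhd m k := by
  have h' : (m : ℤ) ≤ n := by exact_mod_cast h
  unfold basicNhd
  split_ifs <;> rintro s (hs | ⟨a, ha, rfl⟩)
  · exact Or.inl hs
  · exact Or.inr ⟨a, h'.trans ha, rfl⟩
  · exact Or.inl hs
  · exact Or.inr ⟨a, h'.trans ha, rfl⟩

theorem int_mem_basicNhd (n : ℕ) (k j : ℤ) : int j ∈ basicNhd n k ↔ j = k := by
  unfold basicNhd
  split_ifs <;> simp

/-- The topology `τ₃`: points of `𝒞_ℤ` are isolated, and the sets `U_n(k)`, `n = 1, 2, 3, …`,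
form a base at `k ∈ ℤ`. -/
instance : TopologicalSpace S3 where
  IsOpen U := ∀ k : ℤ, int k ∈ U → ∃ n : ℕ, 1 ≤ n ∧ basicNhd n k ⊆ U
  isOpen_univ _ _ := ⟨1, le_rfl, Set.subset_univ _⟩
  isOpen_inter U V hU hV k hk := by
    obtain ⟨m, hm, hmU⟩ := hU k hk.1
    obtain ⟨n, _, hnV⟩ := hV k hk.2
    exact ⟨max m n, le_max_of_le_left hm, Set.subset_inter
      ((basicNhd_anti (le_max_left m n) k).trans hmU)
      ((basicNhd_anti (le_max_right m n) k).trans hnV)⟩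
  isOpen_sUnion 𝒰 h k := by
    rintro ⟨U, hU, hk⟩
    obtain ⟨n, hn, hnU⟩ := h U hU k hk
    exact ⟨n, hn, hnU.trans (Set.subset_sUnion_of_mem hU)⟩

theorem isOpen_iff {U : Set S3} :
    IsOpen U ↔ ∀ k : ℤ, int k ∈ U → ∃ n : ℕ, 1 ≤ n ∧ basicNhd n k ⊆ U := Iff.rfl

theorem isOpen_singleton_bi (x : ExtBicyclic) : IsOpen ({bi x} : Set S3) :=
  isOpen_iff.2 fun k hk => by simp at hk

theorem isOpen_basicNhd {n : ℕ} (hn : 1 ≤ n) (k : ℤ) : IsOpen (basicNhd n k) :=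
  isOpen_iff.2 fun j hj => by
    rw [int_mem_basicNhd] at hj
    subst hj
    exact ⟨n, hn, subset_rfl⟩

theorem nhds_int_hasBasis (k : ℤ) :
    (nhds (int k)).HasBasis (fun n : ℕ => 1 ≤ n) (fun n => basicNhd n k) := by
  refine ⟨fun U => ⟨fun hU => ?_, ?_⟩⟩
  · obtain ⟨V, hVU, hV, hk⟩ := mem_nhds_iff.1 hU
    obtain ⟨n, hn, hnV⟩ := isOpen_iff.1 hV k hk
    exact ⟨n, hn, hnV.trans hVU⟩
  · rintro ⟨n, hn, hnU⟩
    exact Filter.mem_of_superset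
      ((isOpen_basicNhd hn k).mem_nhds ((int_mem_basicNhd n k k).2 rfl)) hnU

end S3

/-- For a subset `C` of a semigroup, `↑C = C ∪ L_C`, where `L_C` is the set of all `x ∉ C` such
that `x * y ∈ C` for some `y ∈ C`. (For an inverse subsemigroup `C` of an inverse semigroup this
is the upper closure of `C` in the natural partial order.) -/
def upperClosureIn {T : Type*} [Mul T] (C : Set T) : Set T :=
  C ∪ {x | x ∉ C ∧ ∃ y ∈ C, x * y ∈ C}

/-! Write e_n = (n, n), I for the complement of 𝒞_ℤ, and φ(k) = (0, k)f, where f is the identity of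
I found below. Points of 𝒞_ℤ are isolated, so upward closedness makes I an ideal. Points of 𝒞_ℤ
close to a point of I have large coordinates, so every e_n acts trivially on I. By density so does
every yy⁻¹, hence I is a group, and z ↦ zf is a retraction of T onto I sending (a, b) to φ(b - a).
Local compactness enters through one device: if a diagonal crosses the boundary of a compact
neighbourhood of f, pass to an ultrafilter limit of the crossing points. Multiplying by f shows that
the limit is f, and conjugation by (1, 0) or (0, 1) fixes f but moves each point across the
boundary, a contradiction. Along the main diagonal this gives e_n → f (`tendsto_idem_identity`);
with one crossing on each diagonal it shows that φ(d) does not accumulate at f as d → ∞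
(`eventually_notMem_nhds_identity`). So φ(ℤ) is a discrete infinite cyclic group. As the image of
𝒞_ℤ under the retraction it is dense in I, and discreteness makes it all of I
(`exists_eq_diagonal`). -/

section ExtBicyclicClosure

open Filter Topology

/-! ### Inverses and idempotents of 𝒞_ℤ. -/

variable {T : Type*} [InverseSemigroup T]

theorem InverseSemigroup.inv_inv' (x : T) : x⁻¹⁻¹ = x :=
  (inv_unique x⁻¹ x (inv_mul_inv x) (mul_inv_mul x)).symm

theorem map_extBicyclic_inv (ι : ExtBicyclic →ₙ* T) (x : ExtBicyclic) :
    (ι x)⁻¹ = ι ⟨x.snd, x.fst⟩ := by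
  refine (InverseSemigroup.inv_unique _ _ ?_ ?_).symm <;> simp only [← map_mul] <;> congr 1 <;>
    ext <;> simp only [ExtBicyclic.mul_fst, ExtBicyclic.mul_snd] <;> omega

theorem map_extBicyclic_mul_inv (ι : ExtBicyclic →ₙ* T) (x : ExtBicyclic) :
    ι x * (ι x)⁻¹ = ι ⟨x.fst, x.fst⟩ := by
  rw [map_extBicyclic_inv, ← map_mul]; congr 1
  ext <;> simp only [ExtBicyclic.mul_fst, ExtBicyclic.mul_snd] <;> omega

theorem map_extBicyclic_inv_mul (ι : ExtBicyclic →ₙ* T) (x : ExtBicyclic) :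
    (ι x)⁻¹ * ι x = ι ⟨x.snd, x.snd⟩ := by
  rw [map_extBicyclic_inv, ← map_mul]; congr 1
  ext <;> simp only [ExtBicyclic.mul_fst, ExtBicyclic.mul_snd] <;> omega

theorem ExtBicyclic.idem_mul (n : ℤ) (x : ExtBicyclic) (h : n ≤ x.fst) : ⟨n, n⟩ * x = x := by
  ext <;> simp only [mul_fst, mul_snd] <;> omega

theorem ExtBicyclic.idem_mul_idem (m n : ℤ) :
    (⟨m, m⟩ * ⟨n, n⟩ : ExtBicyclic) = ⟨max m n, max m n⟩ := by
  ext <;> simp only [mul_fst, mul_snd] <;> omega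

theorem inv_notMem_range {ι : ExtBicyclic →ₙ* T} {x : T} (hx : x ∉ Set.range ι) : x⁻¹ ∉ Set.range ι := by
  rintro ⟨c, hc⟩
  exact hx ⟨_, (map_extBicyclic_inv ι c).symm.trans (hc ▸ InverseSemigroup.inv_inv' x)⟩

theorem idem_mul_ne_iff {ι : ExtBicyclic →ₙ* T} (hι : Function.Injective ι) (n : ℤ) (x : ExtBicyclic) :
    ι ⟨n, n⟩ * (ι x * (ι x)⁻¹) ≠ ι ⟨n, n⟩ ↔ n < x.fst := by
  rw [map_extBicyclic_mul_inv, ← map_mul, ExtBicyclic.idem_mul_idem, ne_eq, hι.eq_iff]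
  simp only [ExtBicyclic.mk.injEq]
  omega

/-! ### Isolated points, and the complement as an ideal. -/

variable [TopologicalSpace T] [TopologicalInverseSemigroup T] [T2Space T]
  {ι : ExtBicyclic →ₙ* T}

/-- Inversion reverses products, by continuity. -/
theorem mul_inv_rev_of_denseRange (hd : DenseRange ι) (x y : T) :
    (x * y)⁻¹ = y⁻¹ * x⁻¹ := by
  refine hd.induction_on₂ (p := fun x y => (x * y)⁻¹ = y⁻¹ * x⁻¹)
    (isClosed_eq (by fun_prop) (by fun_prop)) (fun a b => ?_) x y
  rw [← map_mul, map_extBicyclic_inv, map_extBicyclic_inv, map_extBicyclic_inv, ← map_mul]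
  congr 1
  ext <;> simp only [ExtBicyclic.mul_fst, ExtBicyclic.mul_snd] <;> omega

theorem isOpen_singleton_map_extBicyclic (hι : Function.Injective ι) (hd : DenseRange ι)
    (c : ExtBicyclic) : IsOpen ({ι c} : Set T) := by
  -- Idempotents decrease as the index grows: the two conditions on e_m say m > n - 1 and m < n + 1.
  let O : ℤ → Set T := fun n =>
    {y | ι ⟨n - 1, n - 1⟩ * y ≠ ι ⟨n - 1, n - 1⟩ ∧ y * ι ⟨n + 1, n + 1⟩ ≠ y}
  have hO : ∀ n, IsOpen (O n) := fun n =>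
    (isOpen_ne_fun (by fun_prop) (by fun_prop)).and (isOpen_ne_fun (by fun_prop) (by fun_prop))
  have hmem : ∀ m n, ι ⟨m, m⟩ ∈ O n ↔ m = n := by
    intro m n
    simp only [O, Set.mem_ofPred_eq, ne_eq, ← map_mul, hι.eq_iff, ExtBicyclic.idem_mul_idem,
      ExtBicyclic.mk.injEq]
    omega
  have hV : IsOpen {x : T | x * x⁻¹ ∈ O c.fst ∧ x⁻¹ * x ∈ O c.snd} :=
    ((hO _).preimage (by fun_prop)).inter ((hO _).preimage (by fun_prop))
  convert hV
  symm
  refine Set.eq_singleton_iff_unique_mem.2 ⟨?_, fun y hy => ?_⟩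
  · simp only [Set.mem_ofPred_eq, map_extBicyclic_mul_inv, map_extBicyclic_inv_mul, hmem, and_self]
  -- Otherwise the open set minus ι c is nonempty, so by density it contains another point of 𝒞_ℤ.
  · by_contra hne
    obtain ⟨d, hd1, hd2⟩ := hd.exists_mem_open (hV.inter (isOpen_ne (x := ι c))) ⟨y, hy, hne⟩
    simp only [Set.mem_ofPred_eq, map_extBicyclic_mul_inv, map_extBicyclic_inv_mul, hmem] at hd1
    exact hd2 (congrArg ι (ExtBicyclic.ext hd1.1 hd1.2))

theorem map_mul_notMem_range (hd : DenseRange ι)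
    (hup : upperClosureIn (Set.range ι) = Set.range ι) {x : T} (hx : x ∉ Set.range ι)
    (y : ExtBicyclic) : ι y * x ∉ Set.range ι := by
  have key : ∀ {x : T}, x ∉ Set.range ι → ∀ y, x * ι y ∉ Set.range ι := fun {x} hx y h =>
    hx (hup ▸ Or.inr ⟨hx, ι y, ⟨y, rfl⟩, h⟩)
  have hinv : ∀ {x : T}, x ∈ Set.range ι → x⁻¹ ∈ Set.range ι := by
    rintro _ ⟨a, rfl⟩
    exact ⟨_, (map_extBicyclic_inv ι a).symm⟩
  intro h
  have h1 := hinv h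
  rw [mul_inv_rev_of_denseRange hd, map_extBicyclic_inv] at h1
  exact key (fun h2 => hx (InverseSemigroup.inv_inv' x ▸ hinv h2)) _ h1

/-- If x and y lie outside and xy = c, then c is isolated, so x can be moved to a nearby d in 𝒞_ℤ
with dy = c; this reduces to `map_mul_notMem_range`. -/
theorem mul_notMem_range_of_left (hι : Function.Injective ι) (hd : DenseRange ι)
    (hup : upperClosureIn (Set.range ι) = Set.range ι) {x : T} (hx : x ∉ Set.range ι)
    (y : T) : x * y ∉ Set.range ι := by
  by_cases hy : y ∈ Set.range ι
  · exact fun h => hx (hup ▸ Or.inr ⟨hx, y, hy, h⟩)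
  rintro ⟨c, hc⟩
  obtain ⟨d, h⟩ := hd.exists_mem_open ((isOpen_singleton_map_extBicyclic hι hd c).preimage
    (continuous_id.mul continuous_const : Continuous fun z : T => z * y)) ⟨x, hc.symm⟩
  exact map_mul_notMem_range hd hup hy d ⟨c, (Set.mem_singleton_iff.1 h).symm⟩

theorem mul_notMem_range_of_right (hι : Function.Injective ι) (hd : DenseRange ι)
    (hup : upperClosureIn (Set.range ι) = Set.range ι) (y : T) {x : T}
    (hx : x ∉ Set.range ι) : y * x ∉ Set.range ι := by
  by_cases hy : y ∈ Set.range ι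
  · obtain ⟨y, rfl⟩ := hy
    exact map_mul_notMem_range hd hup hx y
  · exact mul_notMem_range_of_left hι hd hup hy x

/-! ### Trivial action of idempotents; the group structure of the complement. -/

/-- The open set of the elements whose left idempotent lies strictly below the idempotent
`(n, n)`. -/
theorem isOpen_idem_mul_ne (n : ℤ) :
    IsOpen {y : T | ι ⟨n, n⟩ * (y * y⁻¹) ≠ ι ⟨n, n⟩} :=
  isOpen_ne_fun (by fun_prop) (by fun_prop)

theorem idem_mul_ne_of_notMem (hι : Function.Injective ι) (hd : DenseRange ι)
    (hup : upperClosureIn (Set.range ι) = Set.range ι) (n : ℤ) {x : T}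
    (hx : x ∉ Set.range ι) : ι ⟨n, n⟩ * (x * x⁻¹) ≠ ι ⟨n, n⟩ := fun h =>
  mul_notMem_range_of_right hι hd hup _ (mul_notMem_range_of_left hι hd hup hx x⁻¹) ⟨_, h.symm⟩

/-- Points (a, b) of 𝒞_ℤ close to x satisfy a > n, and these are fixed by e_n; the equality passes
to the limit. -/
theorem idem_mul_eq_self (hι : Function.Injective ι) (hd : DenseRange ι)
    (hup : upperClosureIn (Set.range ι) = Set.range ι) (n : ℤ) {x : T}
    (hx : x ∉ Set.range ι) : ι ⟨n, n⟩ * x = x := by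
  by_contra hne
  obtain ⟨c, h1, h2⟩ := hd.exists_mem_open ((isOpen_idem_mul_ne n).inter
    (isOpen_ne_fun (f := fun y : T => ι ⟨n, n⟩ * y) (g := id) (by fun_prop) (by fun_prop)))
    ⟨x, idem_mul_ne_of_notMem hι hd hup n hx, hne⟩
  refine h2 ?_
  have := (idem_mul_ne_iff hι n c).1 h1
  rw [← map_mul, ExtBicyclic.idem_mul _ _ this.le, id]

theorem mul_idem_eq_self (hι : Function.Injective ι) (hd : DenseRange ι)
    (hup : upperClosureIn (Set.range ι) = Set.range ι) (n : ℤ) {x : T}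
    (hx : x ∉ Set.range ι) : x * ι ⟨n, n⟩ = x := by
  have := congrArg (·⁻¹) (idem_mul_eq_self hι hd hup n (inv_notMem_range hx))
  simpa only [mul_inv_rev_of_denseRange hd, InverseSemigroup.inv_inv', map_extBicyclic_inv]
    using this

theorem mul_inv_mul_of_notMem (hι : Function.Injective ι) (hd : DenseRange ι)
    (hup : upperClosureIn (Set.range ι) = Set.range ι) (y : T) {g : T}
    (hg : g ∉ Set.range ι) : y * y⁻¹ * g = g := by
  refine hd.induction_on (p := fun y => y * y⁻¹ * g = g) y
    (isClosed_eq (by fun_prop) (by fun_prop)) (fun a => ?_)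
  rw [map_extBicyclic_mul_inv, idem_mul_eq_self hι hd hup _ hg]

theorem mul_mul_inv_of_notMem (hι : Function.Injective ι) (hd : DenseRange ι)
    (hup : upperClosureIn (Set.range ι) = Set.range ι) (y : T) {g : T}
    (hg : g ∉ Set.range ι) : g * (y * y⁻¹) = g := by
  refine hd.induction_on (p := fun y => g * (y * y⁻¹) = g) y
    (isClosed_eq (by fun_prop) (by fun_prop)) (fun a => ?_)
  rw [map_extBicyclic_mul_inv, mul_idem_eq_self hι hd hup _ hg]

/-- The complement of `𝒞_ℤ` is a group with identity `f`. -/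
theorem exists_identity_of_compl (hι : Function.Injective ι) (hd : DenseRange ι)
    (hup : upperClosureIn (Set.range ι) = Set.range ι) {x : T} (hx : x ∉ Set.range ι) :
    ∃ f : T, f ∉ Set.range ι ∧ (∀ y ∉ Set.range ι, f * y = y) ∧
      (∀ y ∉ Set.range ι, y * f = y) ∧ ∀ y ∉ Set.range ι, y * y⁻¹ = f := by
  have hf := mul_notMem_range_of_left hι hd hup hx x⁻¹
  refine ⟨x * x⁻¹, hf, fun y hy => mul_inv_mul_of_notMem hι hd hup x hy,
    fun y hy => mul_mul_inv_of_notMem hι hd hup x hy, fun y hy => ?_⟩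
  rw [← mul_inv_mul_of_notMem hι hd hup x (mul_notMem_range_of_left hι hd hup hy y⁻¹)]
  exact mul_mul_inv_of_notMem hι hd hup y hf

/-- Since f absorbs e_N, both elements may be multiplied by e_N with N large, after which they
coincide. -/
theorem map_mul_identity (hι : Function.Injective ι) (hd : DenseRange ι)
    (hup : upperClosureIn (Set.range ι) = Set.range ι) {f : T} (hf : f ∉ Set.range ι)
    {x y : ExtBicyclic} (h : x.snd - x.fst = y.snd - y.fst) : ι x * f = ι y * f := by
  rw [← idem_mul_eq_self hι hd hup (max x.snd y.snd) hf, ← mul_assoc, ← mul_assoc, ← map_mul,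
    ← map_mul]
  congr 2
  ext <;> simp only [ExtBicyclic.mul_fst, ExtBicyclic.mul_snd] <;> omega

theorem identity_mul_comm (hι : Function.Injective ι) (hd : DenseRange ι)
    (hup : upperClosureIn (Set.range ι) = Set.range ι) {f : T} (hf : f ∉ Set.range ι)
    (hl : ∀ y ∉ Set.range ι, f * y = y) (hr : ∀ y ∉ Set.range ι, y * f = y) (z : T) :
    f * z = z * f := by
  rw [← hr _ (mul_notMem_range_of_left hι hd hup hf z), mul_assoc,
    hl _ (mul_notMem_range_of_right hι hd hup z hf)]

/-! ### Convergence along diagonals. -/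

/-- A limit along an ultrafilter of pairwise distinct points of `𝒞_ℤ` lies outside `𝒞_ℤ`. -/
theorem notMem_range_of_tendsto {α : Type*} {F : Filter α} [F.NeBot] (hι : Function.Injective ι)
    (hd : DenseRange ι) {u : α → ExtBicyclic} {z : T} (h : Tendsto (fun i => ι (u i)) F (𝓝 z))
    (hu : ∀ c, ∀ᶠ i in F, u i ≠ c) : z ∉ Set.range ι := by
  rintro ⟨c, rfl⟩
  obtain ⟨i, h1, h2⟩ := ((h.eventually_mem
    ((isOpen_singleton_map_extBicyclic hι hd c).mem_nhds rfl)).and (hu c)).exists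
  exact h2 (hι h1)

theorem eq_of_tendsto_of_tendsto_mul {α : Type*} {F : Filter α} [F.NeBot] {f : T}
    (hr : ∀ y ∉ Set.range ι, y * f = y) {u : α → T} {z w : T} (hz : z ∉ Set.range ι)
    (h : Tendsto u F (𝓝 z)) (h' : Tendsto (fun i => u i * f) F (𝓝 w)) : z = w :=
  hr z hz ▸ tendsto_nhds_unique (h.mul_const f) h'

theorem tendsto_idem_identity [LocallyCompactSpace T] (hι : Function.Injective ι)
    (hd : DenseRange ι) (hup : upperClosureIn (Set.range ι) = Set.range ι) {f : T}
    (hf : f ∉ Set.range ι) (hl : ∀ y ∉ Set.range ι, f * y = y)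
    (hr : ∀ y ∉ Set.range ι, y * f = y) (hi : ∀ y ∉ Set.range ι, y * y⁻¹ = f) :
    Tendsto (fun n : ℕ => ι ⟨n, n⟩) atTop (𝓝 f) := by
  have key : ∀ {K : Set T}, IsCompact K → ∀ F : Ultrafilter ℕ, (F : Filter ℕ) ≤ atTop →
      (∀ᶠ n : ℕ in F, ι ⟨n, n⟩ ∈ K) → Tendsto (fun n : ℕ => ι ⟨n, n⟩) F (𝓝 f) := by
    intro K hK F hF hFK
    obtain ⟨z, -, hz⟩ := hK.ultrafilter_le_nhds (F.map fun n : ℕ => ι ⟨n, n⟩)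
      (le_principal_iff.2 hFK)
    have hz' : Tendsto (fun n : ℕ => ι ⟨n, n⟩) F (𝓝 z) := hz
    have hzC := notMem_range_of_tendsto hι hd hz' fun c =>
      hF <| (eventually_gt_atTop c.fst.toNat).mono fun n hn h => by
        have := congrArg ExtBicyclic.fst h
        simp only at this
        omega
    have := eq_of_tendsto_of_tendsto_mul hr hzC hz' (w := f) (by
      simp only [idem_mul_eq_self hι hd hup _ hf, tendsto_const_nhds])
    rwa [← this]
  obtain ⟨K, hK, hKf⟩ := exists_compact_mem_nhds f
  -- For c in 𝒞_ℤ close to f, the idempotent cc⁻¹ is close to ff⁻¹ = f and has large index.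
  have hfreq : ∀ N : ℕ, ∃ n ≥ N, ι ⟨n, n⟩ ∈ K := by
    intro N
    have hopen : IsOpen {y : T | ι ⟨N, N⟩ * (y * y⁻¹) ≠ ι ⟨N, N⟩ ∧ y * y⁻¹ ∈ interior K} :=
      (isOpen_idem_mul_ne _).inter (isOpen_interior.preimage (by fun_prop))
    obtain ⟨c, h1, h2⟩ := hd.exists_mem_open hopen
      ⟨f, idem_mul_ne_of_notMem hι hd hup _ hf, by
        rw [hi f hf]; exact mem_interior_iff_mem_nhds.2 hKf⟩
    rw [idem_mul_ne_iff hι] at h1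
    refine ⟨c.fst.toNat, by omega, ?_⟩
    rw [map_extBicyclic_mul_inv] at h2
    rw [Int.toNat_of_nonneg (by omega)]
    exact interior_subset h2
  have hev : ∀ᶠ n : ℕ in atTop, ι ⟨n, n⟩ ∈ K := by
    by_contra hcon
    have hB : ∃ᶠ n : ℕ in atTop, ι ⟨n, n⟩ ∈ K ∧ ι ⟨(n + 1 : ℕ), (n + 1 : ℕ)⟩ ∉ K := by
      rw [frequently_atTop]
      intro N
      by_contra! hno
      obtain ⟨n, hn, hnK⟩ := hfreq N
      refine hcon (eventually_atTop.2 ⟨n, fun m hm => ?_⟩)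
      induction m, hm using Nat.le_induction with
      | base => exact hnK
      | succ m hm ih => exact hno m (hn.trans hm) ih
    rw [frequently_iff_neBot] at hB
    let F := Ultrafilter.of (atTop ⊓ 𝓟 {n : ℕ | ι ⟨n, n⟩ ∈ K ∧ ι ⟨(n + 1 : ℕ), (n + 1 : ℕ)⟩ ∉ K})
    have hF := Ultrafilter.of_le
      (atTop ⊓ 𝓟 {n : ℕ | ι ⟨n, n⟩ ∈ K ∧ ι ⟨(n + 1 : ℕ), (n + 1 : ℕ)⟩ ∉ K})
    have hFB : ∀ᶠ n : ℕ in F, ι ⟨n, n⟩ ∈ K ∧ ι ⟨(n + 1 : ℕ), (n + 1 : ℕ)⟩ ∉ K :=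
      le_principal_iff.1 (hF.trans inf_le_right)
    have h1 := key hK F (hF.trans inf_le_left) (hFB.mono fun _ h => h.1)
    -- Conjugation turns e_n into e_(n+1) and fixes f, so e_(n+1) → f along F although e_(n+1) ∉ K.
    have h2 := (h1.const_mul (ι ⟨1, 0⟩)).mul_const (ι ⟨0, 1⟩)
    have h3 : ι ⟨1, 0⟩ * f * ι ⟨0, 1⟩ = f := by
      rw [mul_assoc, identity_mul_comm hι hd hup hf hl hr, ← mul_assoc, ← map_mul]
      exact (map_mul_identity hι hd hup hf (y := ⟨0, 0⟩)
        (by simp only [ExtBicyclic.mul_fst, ExtBicyclic.mul_snd]; omega)).trans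
        (idem_mul_eq_self hι hd hup 0 hf)
    rw [h3] at h2
    obtain ⟨n, hn1, hn2⟩ := ((h2.eventually_mem hKf).and hFB).exists
    refine hn2.2 ?_
    convert (show _ ∈ K from hn1) using 1
    simp only [← map_mul]
    congr 1
    ext <;> simp only [ExtBicyclic.mul_fst, ExtBicyclic.mul_snd] <;> omega
  rw [tendsto_iff_ultrafilter]
  exact fun F hF => key hK F hF (hF hev)

theorem tendsto_diagonal [LocallyCompactSpace T] (hι : Function.Injective ι)
    (hd : DenseRange ι) (hup : upperClosureIn (Set.range ι) = Set.range ι) {f : T}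
    (hf : f ∉ Set.range ι) (hl : ∀ y ∉ Set.range ι, f * y = y)
    (hr : ∀ y ∉ Set.range ι, y * f = y) (hi : ∀ y ∉ Set.range ι, y * y⁻¹ = f) (k : ℤ) :
    Tendsto (fun n : ℕ => ι ⟨n, n + k⟩) atTop (𝓝 (ι ⟨0, k⟩ * f)) := by
  rw [← identity_mul_comm hι hd hup hf hl hr]
  refine ((tendsto_idem_identity hι hd hup hf hl hr hi).mul_const (ι ⟨0, k⟩)).congr fun n => ?_
  rw [← map_mul]
  congr 1
  ext <;> simp only [ExtBicyclic.mul_fst, ExtBicyclic.mul_snd] <;> omega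

/-! ### Discreteness of the complement and its identification with ℤ. -/

/-- The powers of the generator of the complement of `𝒞_ℤ` do not accumulate at the identity. -/
theorem eventually_notMem_nhds_identity [LocallyCompactSpace T] (hι : Function.Injective ι)
    (hd : DenseRange ι) (hup : upperClosureIn (Set.range ι) = Set.range ι) {f : T}
    (hf : f ∉ Set.range ι) (hl : ∀ y ∉ Set.range ι, f * y = y)
    (hr : ∀ y ∉ Set.range ι, y * f = y) (hi : ∀ y ∉ Set.range ι, y * y⁻¹ = f) :
    ∃ W ∈ 𝓝 f, ∀ᶠ d : ℕ in atTop, ι ⟨0, d⟩ * f ∉ W := by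
  by_contra! hcon
  have hne : (atTop ⊓ comap (fun d : ℕ => ι ⟨0, d⟩ * f) (𝓝 f)).NeBot := by
    rw [inf_comm]
    refine ((𝓝 f).basis_sets.comap _).inf_neBot_iff.2 fun {W} hW s hs => ?_
    obtain ⟨d, h1, h2⟩ := ((hcon W hW).and_eventually hs).exists
    exact ⟨d, h1, h2⟩
  let F := Ultrafilter.of (atTop ⊓ comap (fun d : ℕ => ι ⟨0, d⟩ * f) (𝓝 f))
  have hF := Ultrafilter.of_le (atTop ⊓ comap (fun d : ℕ => ι ⟨0, d⟩ * f) (𝓝 f))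
  have hFtop : (F : Filter ℕ) ≤ atTop := hF.trans inf_le_left
  have hFf : Tendsto (fun d : ℕ => ι ⟨0, d⟩ * f) F (𝓝 f) :=
    tendsto_iff_comap.2 (hF.trans inf_le_right)
  have hdist : ∀ a : ℕ → ℤ, ∀ c, ∀ᶠ d : ℕ in F, (⟨a d, a d + d⟩ : ExtBicyclic) ≠ c :=
    fun a c => hFtop <| (eventually_gt_atTop (c.snd - c.fst).toNat).mono fun n hn h => by
      subst h
      simp only at hn
      omega
  obtain ⟨K, hK, hKf⟩ := exists_compact_mem_nhds f
  have hlim : ∀ a : ℕ → ℤ, (∀ᶠ d : ℕ in F, ι ⟨a d, a d + d⟩ ∈ K) →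
      ∃ z ∉ Set.range ι, Tendsto (fun d : ℕ => ι ⟨a d, a d + d⟩) F (𝓝 z) := by
    intro a ha
    obtain ⟨z, -, hz⟩ := hK.ultrafilter_le_nhds (F.map fun d : ℕ => ι ⟨a d, a d + d⟩)
      (le_principal_iff.2 ha)
    exact ⟨z, notMem_range_of_tendsto hι hd (show Tendsto _ _ _ from hz) (hdist a), hz⟩
  -- A limit z of the points (0, d) would give zz⁻¹ = e_0, but zz⁻¹ lies outside 𝒞_ℤ.
  have hrow : ∀ᶠ d : ℕ in F, ι ⟨0, 0 + d⟩ ∉ K := by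
    by_contra h
    obtain ⟨z, hz, hzlim⟩ := hlim 0 (not_not.1 (mt Ultrafilter.eventually_not.2 h))
    have h1 := hzlim.mul hzlim.inv
    simp only [map_extBicyclic_mul_inv, Pi.zero_apply] at h1
    exact mul_notMem_range_of_left hι hd hup hz z⁻¹
      ⟨_, tendsto_nhds_unique tendsto_const_nhds h1⟩
  -- Each such diagonal starts outside K and tends to φ(d), which is interior to K, so it enters K
  -- somewhere.
  have hstep : ∀ᶠ d : ℕ in F, ∃ a : ℕ, ι ⟨a, a + d⟩ ∉ K ∧
      ι ⟨(a + 1 : ℕ), (a + 1 : ℕ) + d⟩ ∈ K := by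
    filter_upwards [hrow, hFf (interior_mem_nhds.2 hKf)] with d hd0 hdK
    by_contra! hno
    have hall : ∀ a : ℕ, ι ⟨a, a + d⟩ ∉ K := fun a => by
      induction a with
      | zero => simpa using hd0
      | succ a ih => exact hno a ih
    obtain ⟨a, ha⟩ := ((tendsto_diagonal hι hd hup hf hl hr hi d).eventually_mem
      (mem_interior_iff_mem_nhds.1 hdK)).exists
    exact hall a ha
  choose! a ha using fun d (h : ∃ a : ℕ, ι ⟨a, a + (d : ℕ)⟩ ∉ K ∧
      ι ⟨(a + 1 : ℕ), (a + 1 : ℕ) + d⟩ ∈ K) => h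
  have hstep' := hstep.mono ha
  obtain ⟨z, hz, hzlim⟩ := hlim (fun d => (a d + 1 : ℕ)) (hstep'.mono fun _ h => h.2)
  have hzf : z = f := eq_of_tendsto_of_tendsto_mul hr hz hzlim
    (hFf.congr fun d => map_mul_identity hι hd hup hf (by simp only; omega))
  rw [hzf] at hzlim
  -- This conjugation moves the entry point one step back along its diagonal, to a point outside K.
  have h2 := (hzlim.const_mul (ι ⟨0, 1⟩)).mul_const (ι ⟨1, 0⟩)
  have h3 : ι ⟨0, 1⟩ * f * ι ⟨1, 0⟩ = f := by
    rw [mul_assoc, identity_mul_comm hι hd hup hf hl hr, ← mul_assoc, ← map_mul]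
    exact (map_mul_identity hι hd hup hf (y := ⟨0, 0⟩)
      (by simp only [ExtBicyclic.mul_fst, ExtBicyclic.mul_snd]; omega)).trans
      (idem_mul_eq_self hι hd hup 0 hf)
  rw [h3] at h2
  obtain ⟨n, hn1, hn2⟩ := ((h2.eventually_mem hKf).and hstep').exists
  refine hn2.1 ?_
  convert (show _ ∈ K from hn1) using 1
  simp only [← map_mul]
  congr 1
  ext <;> simp only [ExtBicyclic.mul_fst, ExtBicyclic.mul_snd] <;> omega

/-- The embedding of `ℤ` in the complement of `𝒞_ℤ` is multiplicative. -/
theorem diagonal_mul_diagonal (hι : Function.Injective ι) (hd : DenseRange ι)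
    (hup : upperClosureIn (Set.range ι) = Set.range ι) {f : T} (hf : f ∉ Set.range ι)
    (hl : ∀ y ∉ Set.range ι, f * y = y) (m n : ℤ) :
    ι ⟨0, m⟩ * f * (ι ⟨0, n⟩ * f) = ι ⟨0, m + n⟩ * f := by
  rw [mul_assoc, hl _ (mul_notMem_range_of_right hι hd hup _ hf), ← mul_assoc, ← map_mul]
  exact map_mul_identity hι hd hup hf
    (by simp only [ExtBicyclic.mul_fst, ExtBicyclic.mul_snd]; omega)

theorem exists_isOpen_diagonal_mem_iff [LocallyCompactSpace T] (hι : Function.Injective ι)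
    (hd : DenseRange ι) (hup : upperClosureIn (Set.range ι) = Set.range ι) {f : T}
    (hf : f ∉ Set.range ι) (hl : ∀ y ∉ Set.range ι, f * y = y)
    (hr : ∀ y ∉ Set.range ι, y * f = y) (hi : ∀ y ∉ Set.range ι, y * y⁻¹ = f) :
    ∃ W : Set T, IsOpen W ∧ ∀ k : ℤ, ι ⟨0, k⟩ * f ∈ W ↔ k = 0 := by
  obtain ⟨W, hW, hev⟩ := eventually_notMem_nhds_identity hι hd hup hf hl hr hi
  obtain ⟨M, hM⟩ := eventually_atTop.1 hev
  have hne : ∀ k : ℕ, k ≠ 0 → ι ⟨0, k⟩ * f ≠ f := by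
    intro k hk h
    -- A torsion relation would bring φ back to f at arbitrarily large arguments.
    have hpow : ∀ j : ℕ, ι ⟨0, (j * k : ℕ)⟩ * f = f := fun j => by
      induction j with
      | zero => simpa using idem_mul_eq_self hι hd hup 0 hf
      | succ j ih =>
        have := diagonal_mul_diagonal hι hd hup hf hl (j * k : ℕ) k
        rw [ih, h, hl f hf] at this
        rw [show (((j + 1) * k : ℕ) : ℤ) = (j * k : ℕ) + k by push_cast; ring]
        exact this.symm
    refine hM (M * k) (Nat.le_mul_of_pos_right M (Nat.pos_of_ne_zero hk)) ?_
    rw [hpow]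
    exact mem_of_mem_nhds hW
  have hnhds : W ∩ ⋂ k ∈ (Finset.range M).erase 0, {ι ⟨0, (k : ℕ)⟩ * f}ᶜ ∈ 𝓝 f :=
    inter_mem hW ((biInter_finset_mem _).2 fun k hk =>
      isOpen_compl_singleton.mem_nhds (hne k (Finset.ne_of_mem_erase hk)).symm)
  obtain ⟨V, hV, hVo, hfV⟩ := mem_nhds_iff.1 hnhds
  have hpos : ∀ k : ℕ, ι ⟨0, k⟩ * f ∈ V → k = 0 := by
    intro k hk
    by_contra hk0
    by_cases hkM : M ≤ k
    · exact hM k hkM (hV hk).1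
    · have := (hV hk).2
      simp only [Set.mem_iInter] at this
      exact this k (by simp [hk0]; omega) rfl
  have hinv : ∀ k : ℤ, (ι ⟨0, k⟩ * f)⁻¹ = ι ⟨0, -k⟩ * f := by
    intro k
    have hff : f⁻¹ = f := by
      have := hi f hf
      rwa [hl _ (inv_notMem_range hf)] at this
    rw [mul_inv_rev_of_denseRange hd, hff, map_extBicyclic_inv,
      identity_mul_comm hι hd hup hf hl hr]
    exact map_mul_identity hι hd hup hf (by simp only; omega)
  refine ⟨V ∩ (fun y => y⁻¹) ⁻¹' V, hVo.inter (hVo.preimage continuous_inv), fun k => ⟨?_, ?_⟩⟩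
  · rintro ⟨h1, h2⟩
    rw [Set.mem_preimage, hinv] at h2
    rcases Int.eq_nat_or_neg k with ⟨n, rfl | rfl⟩
    · simp [hpos n h1]
    · rw [neg_neg] at h2
      simp [hpos n h2]
  · rintro rfl
    rw [Set.mem_inter_iff, Set.mem_preimage, hinv, neg_zero, idem_mul_eq_self hι hd hup 0 hf]
    exact ⟨hfV, hfV⟩

/-- W meets the complement only in f. For c in 𝒞_ℤ close to x, the element cfx⁻¹ lies in W, hence
equals f, and so x = cf. -/
theorem exists_eq_diagonal (hι : Function.Injective ι) (hd : DenseRange ι)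
    (hup : upperClosureIn (Set.range ι) = Set.range ι) {f : T} (hf : f ∉ Set.range ι)
    (hl : ∀ y ∉ Set.range ι, f * y = y) (hr : ∀ y ∉ Set.range ι, y * f = y)
    (hi : ∀ y ∉ Set.range ι, y * y⁻¹ = f) {W : Set T} (hWo : IsOpen W)
    (hW : ∀ k : ℤ, ι ⟨0, k⟩ * f ∈ W ↔ k = 0) {x : T} (hx : x ∉ Set.range ι) :
    ∃ k : ℤ, x = ι ⟨0, k⟩ * f := by
  have hfW : f ∈ W := by
    have := (hW 0).2 rfl
    rwa [idem_mul_eq_self hι hd hup 0 hf] at this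
  have hWd : ∀ y : ExtBicyclic, ι y * f ∈ W → y.snd = y.fst := by
    intro y hy
    rw [map_mul_identity hι hd hup hf (y := ⟨0, y.snd - y.fst⟩) (by simp only; omega), hW] at hy
    omega
  have hWf : ∀ y ∉ Set.range ι, y ∈ W → y = f := by
    intro y hy hyW
    by_contra hne
    have hopen : IsOpen {z : T | z * f ∈ W ∧ z * f ≠ z * z⁻¹ * f} :=
      (hWo.preimage (by fun_prop)).inter (isOpen_ne_fun (by fun_prop) (by fun_prop))
    obtain ⟨c, h1, h2⟩ := hd.exists_mem_open hopen
      ⟨y, by rwa [hr y hy], by rwa [hr y hy, hi y hy, hl f hf]⟩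
    refine h2 ?_
    rw [map_extBicyclic_mul_inv]
    exact map_mul_identity hι hd hup hf (by have := hWd c h1; simp only; omega)
  obtain ⟨c, hc⟩ := hd.exists_mem_open (hWo.preimage
    (by fun_prop : Continuous fun z : T => z * f * x⁻¹)) ⟨x, by
      rw [Set.mem_preimage, hr x hx, hi x hx]; exact hfW⟩
  have h1 := hWf _ (mul_notMem_range_of_right hι hd hup _ (inv_notMem_range hx)) hc
  refine ⟨c.snd - c.fst, ?_⟩
  have h2 : x⁻¹ * x = f := by
    simpa only [InverseSemigroup.inv_inv'] using hi x⁻¹ (inv_notMem_range hx)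
  calc x = ι c * f * x⁻¹ * x := by rw [h1, hl x hx]
    _ = ι c * f := by rw [mul_assoc, h2, mul_assoc, hl f hf]
    _ = _ := map_mul_identity hι hd hup hf (by simp only; omega)

end ExtBicyclicClosure

/-! ### The topological isomorphism with S₃. -/

theorem mainTheorem11 {T : Type*} [InverseSemigroup T] [TopologicalSpace T]
    [TopologicalInverseSemigroup T] [T2Space T] [LocallyCompactSpace T]
    (ι : ExtBicyclic →ₙ* T) (hι : Function.Injective ι) (hdense : DenseRange ι)
    (hI : (Set.univ \ upperClosureIn (Set.range ι)).Nonempty)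
    (hup : upperClosureIn (Set.range ι) = Set.range ι) :
    Nonempty (T ≃ₜ* S3) := by
  rw [hup] at hI
  obtain ⟨x, -, hx⟩ := hI
  obtain ⟨f, hf, hl, hr, hi⟩ := exists_identity_of_compl hι hdense hup hx
  obtain ⟨W, hWo, hW⟩ := exists_isOpen_diagonal_mem_iff hι hdense hup hf hl hr hi
  let φ : ℤ → T := fun k => ι ⟨0, k⟩ * f
  have hφC : ∀ k, φ k ∉ Set.range ι := fun k => mul_notMem_range_of_right hι hdense hup _ hf
  have hφmul : ∀ m n, φ m * φ n = φ (m + n) := diagonal_mul_diagonal hι hdense hup hf hl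
  have hφW : ∀ k, φ k ∈ W ↔ k = 0 := hW
  have hιφ : ∀ c : ExtBicyclic, ι c * f = φ (c.snd - c.fst) := fun c =>
    map_mul_identity hι hdense hup hf (by simp only; omega)
  have hιmul : ∀ c n, ι c * φ n = φ (n + c.snd - c.fst) := fun c n => by
    rw [← hl _ (hφC n), ← mul_assoc, hιφ, hφmul]
    congr 1
    omega
  have hmulι : ∀ c n, φ n * ι c = φ (n + c.snd - c.fst) := fun c n => by
    rw [← hr _ (hφC n), mul_assoc, identity_mul_comm hι hdense hup hf hl hr, hιφ, hφmul]
    congr 1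
    omega
  have hφinj : Function.Injective φ := fun m n h => by
    have h1 : φ (m + -n) ∈ W := by
      rw [← hφmul, h, hφmul, hφW]
      omega
    rw [hφW] at h1
    omega
  let Φ : S3 → T := fun s => S3.rec ι φ s
  have hΦmul : ∀ s t, Φ (s * t) = Φ s * Φ t := by
    rintro (c | m) (d | n)
    · exact map_mul ι c d
    · exact (hιmul c n).symm
    · exact (hmulι d m).symm
    · exact (hφmul m n).symm
  have hΦbij : Function.Bijective Φ := by
    constructor
    · rintro (c | m) (d | n) h
      · exact congrArg S3.bi (hι h)
      · exact absurd ⟨c, h⟩ (hφC n)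
      · exact absurd ⟨d, h.symm⟩ (hφC m)
      · exact congrArg S3.int (hφinj h)
    · intro y
      by_cases hy : y ∈ Set.range ι
      · obtain ⟨c, rfl⟩ := hy
        exact ⟨S3.bi c, rfl⟩
      · obtain ⟨k, hk⟩ := exists_eq_diagonal hι hdense hup hf hl hr hi hWo hW hy
        exact ⟨S3.int k, hk.symm⟩
  have hΦcont : Continuous Φ := by
    rw [continuous_iff_continuousAt]
    rintro (c | k)
    · rw [ContinuousAt, (isOpen_singleton_iff_nhds_eq_pure _).1 (S3.isOpen_singleton_bi c)]
      exact tendsto_pure_nhds Φ _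
    · refine (S3.nhds_int_hasBasis k).tendsto_left_iff.2 fun U hU => ?_
      obtain ⟨N, hN⟩ := Filter.eventually_atTop.1
        (tendsto_diagonal hι hdense hup hf hl hr hi k hU)
      have hN' : ∀ a : ℤ, N ≤ a → ι ⟨a, a + k⟩ ∈ U := fun a ha => by
        have := hN a.toNat (by omega)
        change ι ⟨a.toNat, a.toNat + k⟩ ∈ U at this
        rwa [Int.toNat_of_nonneg (by omega)] at this
      refine ⟨max 1 N, le_max_left _ _, ?_⟩
      have hk : Φ (S3.int k) ∈ U := mem_of_mem_nhds hU
      unfold S3.basicNhd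
      split_ifs with h0 <;> rintro s (rfl | ⟨a, ha, rfl⟩)
      · exact hk
      · exact hN' a (by omega)
      · exact hk
      · have := hN' (a - k) (by omega)
        rwa [sub_add_cancel] at this
  have hΦopen : IsOpenMap Φ := by
    rw [isOpenMap_iff_nhds_le]
    rintro (c | k)
    · rw [show nhds (Φ (S3.bi c)) = pure (Φ (S3.bi c)) from
        (isOpen_singleton_iff_nhds_eq_pure _).1 (isOpen_singleton_map_extBicyclic hι hdense c)]
      exact Filter.pure_le_iff.2 fun s hs =>
        (mem_of_mem_nhds hs : S3.bi c ∈ Φ ⁻¹' s)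
    · refine ((S3.nhds_int_hasBasis k).map Φ).ge_iff.2 fun n _ => ?_
      -- The first condition selects the k-th diagonal. The second bounds the first coordinate below
      -- by n + |k|, since for k < 0 the set U_n(k) is indexed by the second coordinate.
      have hopen : IsOpen {y : T | y * φ (-k) ∈ W ∧
          ι ⟨n + |k|, n + |k|⟩ * (y * y⁻¹) ≠ ι ⟨n + |k|, n + |k|⟩} :=
        (hWo.preimage (by fun_prop)).inter (isOpen_idem_mul_ne _)
      refine Filter.mem_of_superset (hopen.mem_nhds ⟨?_, ?_⟩) ?_
      · change φ k * φ (-k) ∈ W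
        rw [hφmul, hφW]
        omega
      · exact idem_mul_ne_of_notMem hι hdense hup _ (hφC k)
      · rintro y ⟨h1, h2⟩
        obtain ⟨c | j, rfl⟩ := hΦbij.2 y
        · change ι c * φ (-k) ∈ W at h1
          rw [hιmul, hφW] at h1
          have h3 := (idem_mul_ne_iff hι _ c).1 h2
          have h4 := le_abs_self k
          have h5 := abs_nonneg k
          refine ⟨S3.bi c, ?_, rfl⟩
          unfold S3.basicNhd
          split_ifs with h0
          · refine Or.inr ⟨c.fst, by omega, congrArg S3.bi (ExtBicyclic.ext rfl ?_)⟩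
            simp only
            omega
          · rw [abs_of_neg (by omega)] at h3
            refine Or.inr ⟨c.snd, by omega, congrArg S3.bi (ExtBicyclic.ext ?_ rfl)⟩
            simp only
            omega
        · change φ j * φ (-k) ∈ W at h1
          rw [hφmul, hφW] at h1
          exact ⟨S3.int j, (S3.int_mem_basicNhd n k j).2 (by omega), rfl⟩
  let e : S3 ≃ T := Equiv.ofBijective Φ hΦbij
  let E : S3 ≃ₜ* T :=
    { e with
      map_mul' := hΦmul
      continuous_toFun := hΦcont
      continuous_invFun := (e.toHomeomorphOfContinuousOpen hΦcont hΦopen).symm.continuous }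
  exact ⟨E.symm⟩
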